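/- For a positive integer $k$ and real $0<q<1$ let $$S_k(q)=\sum_{m=1}^{\infty}\frac{1}{m^k}\,\frac{q^m}{1-q^m},$$ and say that a series $\sum_m u_m$ has merit $a$ if $u_{m+1}/u_m\to e^{-\pi\sqrt a}$ as $m\to\infty$. Let $q_3=e^{-\pi\sqrt3}$, let $B_j$ denote the Bernoulli numbers, and for $n\ge 1$ put $$f_n=2^{6n+1}+1,\qquad e_n=\frac{3^{6n+1}-(-3)^{3n}}{2}-2^{6n},$$ $$\mathcal H_n(z)=(-1)^{n+1}\sum_{m=0}^{n+1}z^{2m-1}\binom{2n+2}{2m}B_{2m}B_{2n+2-2m}.$$ There are rational numbers $E_{k,d}$ ($k=6n+1$, $n\ge1$, $d\in\{0,2,3,6,12\}$) such that for every $n\ge1$, with $k=6n+1$, the following hold. 1. $e_n$ is a positive integer divisible by $7$. 2. The coefficients with $d\ne0$ are given by $$E_{k,2}+2=E_{k,3}=2^{6n}E_{k,12}=-\frac{f_n}{e_n},\qquad E_{k,6}=-f_nE_{k,12}.$$ 3. The coefficient $E_{k,0}$ is given by $$\frac{(6n)!\,(6n+3)(6n+4)}{2^{6n-4}}\,e_n\,E_{k,0}=\frac{48(2n+1)(3n+2)3^{6n}}{(3n+1)(6n+1)\sqrt3}\;\Im\!\left(2\mathcal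 H_{3n}\!\left(\frac{1+\sqrt{-3}}{3}\right)+\mathcal H_{3n}\!\left(\frac{\sqrt{-3}}{3}\right)\right),$$ where $\sqrt{-3}=i\sqrt3$; in particular the right-hand side is rational. 4. The series $S_k(q_3^d)$, $d\in\{2,3,6,12\}$, converge and $$\zeta(k)=E_{k,0}\sqrt3\,\pi^k+\sum_{d\in\{2,3,6,12\}}E_{k,d}\,S_k(q_3^d).$$ 5. The series $S_k(q_3^d)$ has merit $3d^2$ for each $d\in\{2,3,6,12\}$, and the combined series $$\sum_{m=1}^\infty\ \sum_{d\in\{2,3,6,12\}}E_{k,d}\,\frac{1}{m^k}\,\frac{q_3^{dm}}{1-q_3^{dm}}$$ has merit $12$. -/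

import Mathlib

open Filter Topology

noncomputable section

/-- The `m`-th term `(1 / m ^ k) * (q ^ m / (1 - q ^ m))` of the Lambert series `S_k(q)`. -/
def lambertTerm (k : ℕ) (q : ℝ) (m : ℕ) : ℝ :=
  1 / (m : ℝ) ^ k * (q ^ m / (1 - q ^ m))

/-- The Lambert series `S_k(q)`, the sum over `m ≥ 1` of its terms. -/
def lambertS (k : ℕ) (q : ℝ) : ℝ :=
  ∑' m : ℕ, lambertTerm k q (m + 1)

/-- A series with terms `u m` has merit `a` if the ratio of successive terms tends to
`exp (-π √a)`. -/
def HasMerit (u : ℕ → ℝ) (a : ℝ) : Prop :=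
  Tendsto (fun m : ℕ => u (m + 1) / u m) atTop (𝓝 (Real.exp (-(Real.pi * Real.sqrt a))))

/-- `q_3 = exp (-π √3)`. -/
def q3 : ℝ := Real.exp (-(Real.pi * Real.sqrt 3))

/-- `f_n = 2 ^ (6 n + 1) + 1`. -/
def fSeq (n : ℕ) : ℚ := 2 ^ (6 * n + 1) + 1

/-- `e_n = (3 ^ (6 n + 1) - (-3) ^ (3 n)) / 2 - 2 ^ (6 n)`. -/
def eSeq (n : ℕ) : ℚ := (3 ^ (6 * n + 1) - (-3) ^ (3 * n)) / 2 - 2 ^ (6 * n)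

/-- `H_n(z) = (-1)^(n+1) ∑_{m=0}^{n+1} z^(2m-1) C(2n+2, 2m) B_{2m} B_{2n+2-2m}`. -/
def hPoly (n : ℕ) (z : ℂ) : ℂ :=
  (-1) ^ (n + 1) * ∑ m ∈ Finset.range (n + 2),
    z ^ (2 * (m : ℤ) - 1) * ((2 * n + 2).choose (2 * m) : ℂ) *
      ((bernoulli (2 * m) : ℚ) : ℂ) * ((bernoulli (2 * n + 2 - 2 * m) : ℚ) : ℂ)

/-- The square root `√-3` in the upper half plane. -/
def sqrtNegThree : ℂ := Complex.I * (Real.sqrt 3 : ℂ)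

/-- The rational sequence `E_n`, a normalization of the coefficient `c = E_{6n+1,0}` of `√3 π^k`
(meant for `n ≥ 1`). -/
def normalizedCoeff (n : ℕ) (c : ℚ) : ℚ :=
  ((6 * n).factorial * (6 * n + 3) * (6 * n + 4) : ℚ) / 2 ^ (6 * n - 4) * eSeq n * c

end

/-! Put F(τ) = ζ(k) + 2 S_k(x) with x = exp(2πiτ), extended to complex nomes. For odd k this is an
Eichler integral of the Eisenstein series of weight k+1, so it has period 1, satisfies Hecke
relations at 2 and 3, and under τ ↦ -1/τ is multiplied by a power of τ up to the explicit period
`hPoly` (Ramanujan's formula). Let s = √-3. The Hecke relation at 3 links F(s/3) and F((s±1)/3) to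
F(s) and F(3s). Inversion fixes F(s/3) up to a factor and sends the other two points, modulo 1, to
the halves of (3s+3)/2. Two Hecke relations at 2 then leave only s, 3s/2, 3s, 6s, whose nomes are q₃
to the powers 2, 3, 6, 12 (`eichlerSeries_relation`). The weights come out rational because (s±1)/2
are sixth roots of unity, hence k = 6n+1. Collecting the copies of ζ(k) leaves the factor 2^(6n+1)
e_n, and division by it gives the formula. The merit is that of the largest nome, q₃², whose
coefficient is negative. -/

/-! ### Nome series and their relations at the primes 2 and 3 -/

/-- The series `∑ m⁻ᵏ (1 + xᵐ) / (1 - xᵐ)`, which is `ζ(k) + 2 ∑ m⁻ᵏ xᵐ / (1 - xᵐ)`. -/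
noncomputable def nomeSeries (k : ℕ) (x : ℂ) : ℂ :=
  ∑' m : ℕ, 1 / (m : ℂ) ^ k * ((1 + x ^ m) / (1 - x ^ m))

theorem one_sub_pow_ne_zero_of_norm_lt_one {x : ℂ} (hx : ‖x‖ < 1) {m : ℕ} (hm : m ≠ 0) :
    1 - x ^ m ≠ 0 := by
  intro h
  have h1 : ‖x ^ m‖ < 1 := by
    rw [norm_pow]
    exact pow_lt_one₀ (norm_nonneg _) hx hm
  rw [← sub_eq_zero.1 h, norm_one] at h1
  exact lt_irrefl _ h1

theorem summable_nomeSeries {k : ℕ} (hk : 2 ≤ k) {x : ℂ} (hx : ‖x‖ < 1) :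
    Summable fun m : ℕ => 1 / (m : ℂ) ^ k * ((1 + x ^ m) / (1 - x ^ m)) := by
  have hs : Summable fun m : ℕ => 1 / (m : ℝ) ^ k * (2 / (1 - ‖x‖)) :=
    (Real.summable_one_div_nat_pow.2 hk).mul_right _
  refine Summable.of_norm_bounded hs fun m => ?_
  -- The term at m = 0 is 0, by division by zero.
  rcases eq_or_ne m 0 with rfl | hm
  · have : k ≠ 0 := by omega
    simp [this]
  have hpow : ‖x ^ m‖ ≤ ‖x‖ := by
    rw [norm_pow]
    exact pow_le_of_le_one (norm_nonneg _) hx.le hm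
  rw [norm_mul, norm_div, norm_div, norm_pow, Complex.norm_natCast, norm_one]
  have h1 : ‖1 + x ^ m‖ ≤ 2 := by
    refine (norm_add_le _ _).trans ?_
    rw [norm_one]
    linarith
  have h2 : 1 - ‖x‖ ≤ ‖1 - x ^ m‖ := by
    have := norm_sub_norm_le 1 (x ^ m)
    rw [norm_one] at this
    linarith
  have h3 : 0 < 1 - ‖x‖ := by linarith
  gcongr

/-- For odd m, with y = x^m, (1+y)/(1-y) + (1-y)/(1+y) = 2(1+y²)/(1-y²), so these terms cancel
against 2F(x²). The even m = 2j, where x^m and (-x)^m agree, give the correction. -/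
theorem nomeSeries_add_neg {k : ℕ} (hk : 2 ≤ k) {x : ℂ} (hx : ‖x‖ < 1) :
    nomeSeries k x + nomeSeries k (-x) =
      2 * nomeSeries k (x ^ 2) +
        2 / 2 ^ k * (nomeSeries k (x ^ 2) - nomeSeries k (x ^ 4)) := by
  have hx' : ‖-x‖ < 1 := by rwa [norm_neg]
  have hp : ∀ j : ℕ, j ≠ 0 → ‖x ^ j‖ < 1 := fun j hj => by
    rw [norm_pow]
    exact pow_lt_one₀ (norm_nonneg _) hx hj
  have s1 := (summable_nomeSeries hk hx).hasSum
  have s2 := (summable_nomeSeries hk hx').hasSum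
  have s3 := (summable_nomeSeries hk (hp 2 two_ne_zero)).hasSum
  have s4 := (summable_nomeSeries hk (hp 4 four_ne_zero)).hasSum
  have t1 := ((s1.add s2).sub (s3.mul_left 2)).tsum_eq
  have t2 := ((s3.sub s4).mul_left (2 / 2 ^ k)).tsum_eq
  have hinj : Function.Injective fun j : ℕ => 2 * j := fun a b h => by simpa using h
  rw [← hinj.tsum_eq] at t1
  · have : ∀ j : ℕ, 1 / ((2 * j : ℕ) : ℂ) ^ k * ((1 + x ^ (2 * j)) / (1 - x ^ (2 * j))) +
        1 / ((2 * j : ℕ) : ℂ) ^ k * ((1 + (-x) ^ (2 * j)) / (1 - (-x) ^ (2 * j))) -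
        2 * (1 / ((2 * j : ℕ) : ℂ) ^ k *
          ((1 + (x ^ 2) ^ (2 * j)) / (1 - (x ^ 2) ^ (2 * j)))) =
        2 / 2 ^ k * (1 / (j : ℂ) ^ k * ((1 + (x ^ 2) ^ j) / (1 - (x ^ 2) ^ j)) -
          1 / (j : ℂ) ^ k * ((1 + (x ^ 4) ^ j) / (1 - (x ^ 4) ^ j))) := by
      intro j
      have e1 : (-x) ^ (2 * j) = x ^ (2 * j) := by rw [pow_mul, neg_sq, ← pow_mul]
      have e2 : (x ^ 2) ^ (2 * j) = (x ^ 4) ^ j := by rw [← pow_mul, ← pow_mul]; congr 1; ring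
      rw [e1, e2, ← pow_mul x 2 j, Nat.cast_mul, mul_pow]
      push_cast
      generalize (1 + x ^ (2 * j)) / (1 - x ^ (2 * j)) = a
      generalize (1 + (x ^ 4) ^ j) / (1 - (x ^ 4) ^ j) = b
      simp only [div_eq_mul_inv, mul_inv]
      ring
    simp only [this] at t1
    rw [t2] at t1
    unfold nomeSeries
    linear_combination -t1
  · intro m hm
    by_contra hodd
    apply hm
    have hmo : Odd m := by
      rcases Nat.even_or_odd m with ⟨j, hj⟩ | h
      · exact absurd ⟨j, by simp only; omega⟩ hodd
      · exact h
    have hm0 : m ≠ 0 := by rintro rfl; simp at hmo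
    have h1 := one_sub_pow_ne_zero_of_norm_lt_one hx hm0
    have h2 := one_sub_pow_ne_zero_of_norm_lt_one hx' hm0
    have h3 := one_sub_pow_ne_zero_of_norm_lt_one (hp 2 two_ne_zero) hm0
    have e : (x ^ 2) ^ m = (x ^ m) ^ 2 := by rw [← pow_mul, ← pow_mul, mul_comm]
    beta_reduce
    rw [hmo.neg_pow] at h2 ⊢
    rw [e] at h3 ⊢
    generalize x ^ m = y at *
    field_simp
    ring

/-- The hypotheses say that a, b, c are the roots of T³ = abc; this is the cubic analogue of the
cancellation at odd m. -/
theorem sum_one_add_div_one_sub_eq {a b c : ℂ} (ha : 1 - a ≠ 0) (hb : 1 - b ≠ 0) (hc : 1 - c ≠ 0)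
    (h1 : a + b + c = 0) (h2 : a * b + a * c + b * c = 0) :
    (1 + a) / (1 - a) + (1 + b) / (1 - b) + (1 + c) / (1 - c) =
      3 * ((1 + a * b * c) / (1 - a * b * c)) := by
  have hprod : 1 - a * b * c = (1 - a) * (1 - b) * (1 - c) := by linear_combination h1 - h2
  have hsum : (1 + a) * (1 - b) * (1 - c) + (1 + b) * (1 - a) * (1 - c) +
      (1 + c) * (1 - a) * (1 - b) = 3 * (1 + a * b * c) := by linear_combination -h1 - h2
  rw [hprod, ← mul_div_assoc, ← hsum]
  field_simp

theorem nomeSeries_cubeRoots {k : ℕ} (hk : 2 ≤ k) {x ω : ℂ} (hx : ‖x‖ < 1)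
    (hω : ω ^ 2 + ω + 1 = 0) :
    nomeSeries k x + nomeSeries k (ω * x) + nomeSeries k (ω ^ 2 * x) =
      3 * nomeSeries k (x ^ 3) +
        3 / 3 ^ k * (nomeSeries k (x ^ 3) - nomeSeries k (x ^ 9)) := by
  have hω3 : ω ^ 3 = 1 := by linear_combination (ω - 1) * hω
  have hωn : ‖ω‖ = 1 := by
    have : ‖ω‖ ^ 3 = 1 := by rw [← norm_pow, hω3, norm_one]
    exact (pow_eq_one_iff_of_nonneg (norm_nonneg _) three_ne_zero).1 this
  have hx1 : ‖ω * x‖ < 1 := by rwa [norm_mul, hωn, one_mul]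
  have hx2 : ‖ω ^ 2 * x‖ < 1 := by rwa [norm_mul, norm_pow, hωn, one_pow, one_mul]
  have hp : ∀ j : ℕ, j ≠ 0 → ‖x ^ j‖ < 1 := fun j hj => by
    rw [norm_pow]
    exact pow_lt_one₀ (norm_nonneg _) hx hj
  have s1 := (summable_nomeSeries hk hx).hasSum
  have s2 := (summable_nomeSeries hk hx1).hasSum
  have s2' := (summable_nomeSeries hk hx2).hasSum
  have s3 := (summable_nomeSeries hk (hp 3 three_ne_zero)).hasSum
  have s4 := (summable_nomeSeries hk (hp 9 (by norm_num))).hasSum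
  have t1 := (((s1.add s2).add s2').sub (s3.mul_left 3)).tsum_eq
  have t2 := ((s3.sub s4).mul_left (3 / 3 ^ k)).tsum_eq
  have hinj : Function.Injective fun j : ℕ => 3 * j := fun a b h => by simpa using h
  rw [← hinj.tsum_eq] at t1
  · have : ∀ j : ℕ, 1 / ((3 * j : ℕ) : ℂ) ^ k * ((1 + x ^ (3 * j)) / (1 - x ^ (3 * j))) +
        1 / ((3 * j : ℕ) : ℂ) ^ k * ((1 + (ω * x) ^ (3 * j)) / (1 - (ω * x) ^ (3 * j))) +
        1 / ((3 * j : ℕ) : ℂ) ^ k * ((1 + (ω ^ 2 * x) ^ (3 * j)) / (1 - (ω ^ 2 * x) ^ (3 * j))) -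
        3 * (1 / ((3 * j : ℕ) : ℂ) ^ k *
          ((1 + (x ^ 3) ^ (3 * j)) / (1 - (x ^ 3) ^ (3 * j)))) =
        3 / 3 ^ k * (1 / (j : ℂ) ^ k * ((1 + (x ^ 3) ^ j) / (1 - (x ^ 3) ^ j)) -
          1 / (j : ℂ) ^ k * ((1 + (x ^ 9) ^ j) / (1 - (x ^ 9) ^ j))) := by
      intro j
      have e1 : (ω * x) ^ (3 * j) = x ^ (3 * j) := by
        rw [mul_pow, pow_mul ω, hω3, one_pow, one_mul]
      have e1' : (ω ^ 2 * x) ^ (3 * j) = x ^ (3 * j) := by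
        rw [mul_pow, pow_mul (ω ^ 2), ← pow_mul ω, mul_comm 2 3, pow_mul, hω3, one_pow, one_pow,
          one_mul]
      have e2 : (x ^ 3) ^ (3 * j) = (x ^ 9) ^ j := by rw [← pow_mul, ← pow_mul]; congr 1; ring
      rw [e1, e1', e2, ← pow_mul x 3 j, Nat.cast_mul, mul_pow]
      push_cast
      generalize (1 + x ^ (3 * j)) / (1 - x ^ (3 * j)) = a
      generalize (1 + (x ^ 9) ^ j) / (1 - (x ^ 9) ^ j) = b
      simp only [div_eq_mul_inv, mul_inv]
      ring
    simp only [this] at t1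
    rw [t2] at t1
    unfold nomeSeries
    linear_combination -t1
  · intro m hm
    by_contra hnd
    apply hm
    have hm0 : m ≠ 0 := by rintro rfl; exact hnd ⟨0, rfl⟩
    have h1 := one_sub_pow_ne_zero_of_norm_lt_one hx hm0
    have h2 := one_sub_pow_ne_zero_of_norm_lt_one hx1 hm0
    have h2' := one_sub_pow_ne_zero_of_norm_lt_one hx2 hm0
    have h3 := one_sub_pow_ne_zero_of_norm_lt_one (hp 3 three_ne_zero) hm0
    have e : (x ^ 3) ^ m = (x ^ m) ^ 3 := by rw [← pow_mul, ← pow_mul, mul_comm]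
    -- As 3 does not divide m, η = ω^m is again a primitive cube root of unity.
    obtain ⟨η, hη, hη1, hη2⟩ : ∃ η : ℂ, η ^ 2 + η + 1 = 0 ∧ ω ^ m = η ∧ (ω ^ 2) ^ m = η ^ 2 := by
      refine ⟨ω ^ m, ?_, rfl, by rw [← pow_mul, ← pow_mul, mul_comm]⟩
      have hr : m % 3 = 1 ∨ m % 3 = 2 := by
        have : m % 3 ≠ 0 := fun h => hnd ⟨m / 3, by simp only; omega⟩
        omega
      have : ω ^ m = ω ^ (m % 3) := by
        conv_lhs => rw [← Nat.div_add_mod m 3, pow_add, pow_mul, hω3, one_pow, one_mul]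
      rw [this]
      rcases hr with h | h <;> rw [h]
      · linear_combination hω
      · linear_combination (ω ^ 2 - ω + 1) * hω
    beta_reduce
    rw [mul_pow, hη1] at h2 ⊢
    rw [mul_pow, hη2] at h2' ⊢
    rw [e] at h3 ⊢
    generalize x ^ m = y at *
    have key := sum_one_add_div_one_sub_eq h1 h2 h2'
      (by linear_combination y * hη) (by linear_combination (η * y ^ 2) * hη)
    have e3 : y * (η * y) * (η ^ 2 * y) = y ^ 3 := by
      linear_combination (y ^ 3 * (η - 1)) * hη
    rw [e3] at key
    linear_combination (1 / (m : ℂ) ^ k) * key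

/-! ### Double series behind Ramanujan's formula -/

/-- The double series `∑ 1 / (m²ᵃ n²ᵇ (m² τ² - n²))` over positive integers `m` and `n`. -/
noncomputable def quadraticDoubleTerm (a b : ℕ) (τ : ℂ) (p : ℕ × ℕ) : ℂ :=
  1 / (((p.1 : ℂ) + 1) ^ (2 * a) * ((p.2 : ℂ) + 1) ^ (2 * b) *
    (((p.1 : ℂ) + 1) ^ 2 * τ ^ 2 - ((p.2 : ℂ) + 1) ^ 2))

noncomputable def quadraticDoubleSum (a b : ℕ) (τ : ℂ) : ℂ :=
  ∑' p : ℕ × ℕ, quadraticDoubleTerm a b τ p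

/-- Both factors Mτ - N and Mτ + N have imaginary part M · Im τ. -/
theorem sq_im_mul_sq_le_norm (τ : ℂ) (M N : ℝ) :
    τ.im ^ 2 * M ^ 2 ≤ ‖(M : ℂ) ^ 2 * τ ^ 2 - (N : ℂ) ^ 2‖ := by
  have h : (M : ℂ) ^ 2 * τ ^ 2 - (N : ℂ) ^ 2 = (M * τ - N) * (M * τ + N) := by ring
  have h1 := Complex.abs_im_le_norm (M * τ - N)
  have h2 := Complex.abs_im_le_norm (M * τ + N)
  simp only [Complex.sub_im, Complex.add_im, Complex.im_ofReal_mul,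
    Complex.ofReal_im, sub_zero, add_zero] at h1 h2
  rw [h, norm_mul]
  calc τ.im ^ 2 * M ^ 2 = |M * τ.im| * |M * τ.im| := by rw [abs_mul_abs_self]; ring
    _ ≤ _ := by gcongr

/-- Multiplying by the square of the conjugate of τ exchanges the roles of M and N in the previous
bound. -/
theorem sq_mul_sq_im_le_norm_mul (τ : ℂ) (M N : ℝ) :
    τ.im ^ 2 * N ^ 2 ≤ ‖(M : ℂ) ^ 2 * τ ^ 2 - (N : ℂ) ^ 2‖ * ‖τ‖ ^ 2 := by
  have hc : ‖τ‖ ^ 2 = ‖(starRingEnd ℂ) τ ^ 2‖ := by rw [norm_pow, Complex.norm_conj]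
  have h : ((M : ℂ) ^ 2 * τ ^ 2 - (N : ℂ) ^ 2) * (starRingEnd ℂ) τ ^ 2 =
      -(((N : ℝ) : ℂ) ^ 2 * (starRingEnd ℂ) τ ^ 2 - ((M * Complex.normSq τ : ℝ) : ℂ) ^ 2) := by
    push_cast
    rw [← Complex.mul_conj]
    ring
  rw [hc, ← norm_mul, h, norm_neg]
  simpa using sq_im_mul_sq_le_norm ((starRingEnd ℂ) τ) N (M * Complex.normSq τ)

theorem summable_quadraticDoubleTerm {a b : ℕ} (hab : 1 ≤ a + b) {τ : ℂ} (hτ : 0 < τ.im) :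
    Summable (quadraticDoubleTerm a b τ) := by
  have hs1 : Summable fun m : ℕ => 1 / ((m : ℝ) + 1) ^ 2 := by
    have := (summable_nat_add_iff 1).2 (Real.summable_one_div_nat_pow.2 (one_lt_two))
    simpa using this
  have hs := hs1.mul_of_nonneg hs1 (fun m => by positivity) (fun m => by positivity)
  have hτ0 : 0 < ‖τ‖ := norm_pos_iff.2 fun h => by simp [h] at hτ
  obtain ⟨c, hc, hc1, hc2⟩ : ∃ c : ℝ, 0 < c ∧ c ≤ τ.im ^ 2 ∧ c ≤ τ.im ^ 2 / ‖τ‖ ^ 2 :=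
    ⟨min (τ.im ^ 2) (τ.im ^ 2 / ‖τ‖ ^ 2), lt_min (by positivity) (by positivity),
      min_le_left _ _, min_le_right _ _⟩
  refine Summable.of_norm_bounded (hs.mul_left c⁻¹) fun p => ?_
  obtain ⟨m, n⟩ := p
  have hM : (1 : ℝ) ≤ (m : ℝ) + 1 := by simp
  have hN : (1 : ℝ) ≤ (n : ℝ) + 1 := by simp
  have b1 := sq_im_mul_sq_le_norm τ ((m : ℝ) + 1) ((n : ℝ) + 1)
  have b2 := sq_mul_sq_im_le_norm_mul τ ((m : ℝ) + 1) ((n : ℝ) + 1)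
  rw [← div_le_iff₀ (by positivity), mul_div_right_comm] at b2
  have nM : ‖(m : ℂ) + 1‖ = (m : ℝ) + 1 := by exact_mod_cast Complex.norm_natCast (m + 1)
  have nN : ‖(n : ℂ) + 1‖ = (n : ℝ) + 1 := by exact_mod_cast Complex.norm_natCast (n + 1)
  push_cast at b1 b2
  rw [quadraticDoubleTerm, norm_div, norm_one, norm_mul, norm_mul, norm_pow, norm_pow, nM, nN]
  dsimp only
  generalize (m : ℝ) + 1 = M at *
  generalize (n : ℝ) + 1 = N at *
  generalize ‖((m : ℂ) + 1) ^ 2 * τ ^ 2 - ((n : ℂ) + 1) ^ 2‖ = X at *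
  have hX1 : c * M ^ 2 ≤ X := le_trans (by gcongr) b1
  have hX2 : c * N ^ 2 ≤ X := le_trans (by gcongr) b2
  have hX : 0 < X := lt_of_lt_of_le (by positivity) hX1
  -- The terms are dominated by a multiple of 1/(M²N²): one square comes from the powers, the other
  -- from whichever lower bound on X is needed.
  have key : c * (M ^ 2 * N ^ 2) ≤ M ^ (2 * a) * N ^ (2 * b) * X := by
    rcases Nat.eq_zero_or_pos a with rfl | ha
    · have : N ^ 2 ≤ N ^ (2 * b) := pow_le_pow_right₀ hN (by omega)
      calc c * (M ^ 2 * N ^ 2) = N ^ 2 * (c * M ^ 2) := by ring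
        _ ≤ N ^ (2 * b) * X := by gcongr
        _ = _ := by simp
    · have h1 : M ^ 2 ≤ M ^ (2 * a) := pow_le_pow_right₀ hM (by omega)
      have h2 : 1 ≤ N ^ (2 * b) := one_le_pow₀ hN
      calc c * (M ^ 2 * N ^ 2) = M ^ 2 * 1 * (c * N ^ 2) := by ring
        _ ≤ _ := by gcongr
  calc 1 / (M ^ (2 * a) * N ^ (2 * b) * X) ≤ 1 / (c * (M ^ 2 * N ^ 2)) :=
        one_div_le_one_div_of_le (by positivity) key
    _ = _ := by field_simp

theorem hasSum_riemannZeta_two_mul {a : ℕ} (ha : a ≠ 0) :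
    HasSum (fun m : ℕ => 1 / ((m : ℂ) + 1) ^ (2 * a)) (riemannZeta (2 * a)) := by
  have h1 : 1 < 2 * a := by omega
  have hs : Summable fun m : ℕ => 1 / (m : ℂ) ^ (2 * a) :=
    .of_norm <| by simpa using Real.summable_one_div_nat_pow.2 h1
  have hz := zeta_nat_eq_tsum_of_gt_one h1
  push_cast at hz
  rw [hz]
  have := (hasSum_nat_add_iff' 1).2 hs.hasSum
  simpa [ha] using this

theorem hasSum_mul_prod {f g : ℕ → ℂ} {s t : ℂ} (hf : HasSum f s) (hg : HasSum g t) :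
    HasSum (fun p : ℕ × ℕ => f p.1 * g p.2) (s * t) :=
  hf.mul hg (summable_mul_of_summable_norm hf.summable.norm hg.summable.norm)

theorem one_div_pow_mul_pow_mul_sub {a b : ℕ} {M N τ : ℂ} (hM : M ≠ 0) (hN : N ≠ 0)
    (hX : M ^ 2 * τ ^ 2 - N ^ 2 ≠ 0) :
    1 / (M ^ (2 * (a + 1)) * N ^ (2 * b) * (M ^ 2 * τ ^ 2 - N ^ 2)) =
      τ ^ 2 * (1 / (M ^ (2 * a) * N ^ (2 * (b + 1)) * (M ^ 2 * τ ^ 2 - N ^ 2))) -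
        1 / M ^ (2 * (a + 1)) * (1 / N ^ (2 * (b + 1))) := by
  have e : τ ^ 2 * M ^ 2 - (M ^ 2 * τ ^ 2 - N ^ 2) = N ^ 2 := by ring
  generalize M ^ 2 * τ ^ 2 - N ^ 2 = X at *
  rw [mul_add, mul_add, pow_add, pow_add]
  field_simp
  linear_combination -e

theorem quadraticDoubleSum_succ {a b : ℕ} {τ : ℂ} (hτ : 0 < τ.im) :
    quadraticDoubleSum (a + 1) b τ = τ ^ 2 * quadraticDoubleSum a (b + 1) τ -
      riemannZeta (2 * (a + 1 : ℕ)) * riemannZeta (2 * (b + 1 : ℕ)) := by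
  have s1 := (summable_quadraticDoubleTerm (a := a) (b := b + 1) (by omega) hτ).hasSum
  have z1 := hasSum_riemannZeta_two_mul (a := a + 1) (by omega)
  have z2 := hasSum_riemannZeta_two_mul (a := b + 1) (by omega)
  have zz := hasSum_mul_prod z1 z2
  have h := ((s1.mul_left (τ ^ 2)).sub zz).tsum_eq
  rw [quadraticDoubleSum, quadraticDoubleSum, ← h]
  refine tsum_congr fun p => ?_
  have hX : ((p.1 : ℂ) + 1) ^ 2 * τ ^ 2 - ((p.2 : ℂ) + 1) ^ 2 ≠ 0 := by
    have b1 := sq_im_mul_sq_le_norm τ ((p.1 : ℝ) + 1) ((p.2 : ℝ) + 1)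
    push_cast at b1
    exact norm_pos_iff.1 (lt_of_lt_of_le (by positivity) b1)
  exact one_div_pow_mul_pow_mul_sub (Nat.cast_add_one_ne_zero _) (Nat.cast_add_one_ne_zero _) hX

/-- Each step trades a factor m⁻² for τ² n⁻² at the cost of a product of even zeta values. With a =
b = 0 and j = N all the powers move from m to n. -/
theorem quadraticDoubleSum_add (a b j : ℕ) {τ : ℂ} (hτ : 0 < τ.im) :
    quadraticDoubleSum (a + j) b τ = τ ^ (2 * j) * quadraticDoubleSum a (b + j) τ -
      ∑ i ∈ Finset.range j, τ ^ (2 * i) *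
        (riemannZeta (2 * (a + j - i : ℕ)) * riemannZeta (2 * (b + i + 1 : ℕ))) := by
  induction j generalizing a with
  | zero => simp
  | succ j ih =>
    have h := ih (a + 1)
    rw [show a + (j + 1) = a + 1 + j by ring, h, quadraticDoubleSum_succ hτ,
      Finset.sum_range_succ, show a + 1 + j - j = a + 1 by omega, ← add_assoc b j 1]
    ring

/-- Exchanging m and n is the inversion of τ, since m²τ² - n² = -τ²(n²(-1/τ)² - m²). -/
theorem quadraticDoubleSum_swap (N : ℕ) {τ : ℂ} (hτ : τ ≠ 0) :
    quadraticDoubleSum 0 N τ = -(1 / τ ^ 2) * quadraticDoubleSum N 0 (-1 / τ) := by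
  unfold quadraticDoubleSum
  rw [← tsum_mul_left, ← (Equiv.prodComm ℕ ℕ).tsum_eq]
  refine tsum_congr fun p => ?_
  simp only [quadraticDoubleTerm, Equiv.prodComm_apply, Prod.fst_swap, Prod.snd_swap, mul_zero,
    pow_zero, one_mul, mul_one]
  rw [neg_mul, ← mul_neg, ← div_neg, one_div_mul_one_div]
  congr 1
  field_simp
  ring

/-- The ratio (1+x^m)/(1-x^m) is i cot(πmτ), expanded in partial fractions: the pole term 1/(mτ)
sums to ζ(2N+2)/τ and the paired poles at ±n give the double series. -/
theorem nomeSeries_eq_quadraticDoubleSum {N : ℕ} (hN : 1 ≤ N) {τ : ℂ} (hτ : 0 < τ.im) :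
    nomeSeries (2 * N + 1) (Complex.exp (2 * Real.pi * Complex.I * τ)) =
      Complex.I / Real.pi *
        (riemannZeta (2 * (N + 1 : ℕ)) / τ + 2 * τ * quadraticDoubleSum N 0 τ) := by
  have hτ0 : τ ≠ 0 := fun h => by simp [h] at hτ
  have hx : ‖Complex.exp (2 * Real.pi * Complex.I * τ)‖ < 1 :=
    UpperHalfPlane.norm_exp_two_pi_I_lt_one ⟨τ, hτ⟩
  have hs := (hasSum_nat_add_iff' 1).2
    (summable_nomeSeries (k := 2 * N + 1) (by omega) hx).hasSum
  simp only [Finset.range_one, Finset.sum_singleton, pow_zero, sub_self, div_zero, mul_zero,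
    sub_zero] at hs
  have s2 := summable_quadraticDoubleTerm (a := N) (b := 0) (by omega) hτ
  have h2 := s2.hasSum.prod_fiberwise fun m => (s2.prod_factor m).hasSum
  have z := hasSum_riemannZeta_two_mul (a := N + 1) (by omega)
  have h3 := ((z.div_const τ).add (h2.mul_left (2 * τ))).mul_left (Complex.I / Real.pi)
  rw [nomeSeries, ← hs.tsum_eq, quadraticDoubleSum, ← h3.tsum_eq]
  refine tsum_congr fun m => ?_
  have hMpos : (0 : ℝ) < (m : ℝ) + 1 := by positivity
  have him : 0 < (((m : ℂ) + 1) * τ).im := by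
    have : ((m : ℂ) + 1) * τ = (((m : ℝ) + 1 : ℝ) : ℂ) * τ := by push_cast; ring
    rw [this, Complex.im_ofReal_mul]
    positivity
  have hcot := cot_series_rep' (UpperHalfPlane.coe_mem_integerComplement ⟨_, him⟩)
  simp only at hcot
  have hexp : Complex.exp (2 * Real.pi * Complex.I * τ) ^ (m + 1) =
      Complex.exp (2 * Real.pi * Complex.I * (((m : ℂ) + 1) * τ)) := by
    rw [← Complex.exp_nat_mul]
    congr 1
    push_cast
    ring
  have hM : (m : ℂ) + 1 ≠ 0 := Nat.cast_add_one_ne_zero _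
  have hpi : (Real.pi : ℂ) ≠ 0 := Complex.ofReal_ne_zero.2 Real.pi_ne_zero
  have hcoteq := Complex.cot_pi_eq_exp_ratio (((m : ℂ) + 1) * τ)
  have hsum : ∑' n : ℕ, (1 / (((m : ℂ) + 1) * τ - (n + 1)) + 1 / (((m : ℂ) + 1) * τ + (n + 1))) =
      2 * τ * (((m : ℂ) + 1) ^ (2 * N + 1) * ∑' n : ℕ, quadraticDoubleTerm N 0 τ (m, n)) := by
    rw [← tsum_mul_left, ← tsum_mul_left]
    refine tsum_congr fun n => ?_
    have him2 : ∀ r : ℂ, r.im = 0 → ((m : ℂ) + 1) * τ + r ≠ 0 := fun r hr h => by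
      have := congrArg Complex.im h
      rw [Complex.add_im, hr, add_zero, Complex.zero_im] at this
      exact him.ne' this
    have n1 : ((m : ℂ) + 1) * τ + (n + 1) ≠ 0 := him2 _ (by simp)
    have n2 : ((m : ℂ) + 1) * τ - (n + 1) ≠ 0 := by
      rw [sub_eq_add_neg]
      exact him2 _ (by simp)
    have e : ((m : ℂ) + 1) ^ 2 * τ ^ 2 - ((n : ℂ) + 1) ^ 2 =
      (((m : ℂ) + 1) * τ - (n + 1)) * (((m : ℂ) + 1) * τ + (n + 1)) := by ring
    simp only [quadraticDoubleTerm]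
    rw [e]
    field_simp
    ring
  rw [hsum] at hcot
  rw [hexp]
  push_cast
  have hL : (1 + Complex.exp (2 * Real.pi * Complex.I * (((m : ℂ) + 1) * τ))) /
      (1 - Complex.exp (2 * Real.pi * Complex.I * (((m : ℂ) + 1) * τ))) =
      Complex.I / Real.pi * (Real.pi * Complex.cot (Real.pi * (((m : ℂ) + 1) * τ))) := by
    rw [hcoteq, add_comm]
    field_simp
  rw [hL, eq_add_of_sub_eq hcot]
  generalize ∑' n : ℕ, quadraticDoubleTerm N 0 τ (m, n) = Y
  field_simp
  ring

/-! ### Ramanujan's formula -/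

theorem zeta_two_mul_mul_zeta_two_mul (m l : ℕ) :
    -(2 * (riemannZeta (2 * m) * riemannZeta (2 * l))) =
      (-1) ^ (m + l + 1) * (2 * Real.pi) ^ (2 * m + 2 * l) / 2 *
        ((bernoulli (2 * m) : ℚ) / (2 * m).factorial *
          ((bernoulli (2 * l) : ℚ) / (2 * l).factorial)) := by
  rw [riemannZeta_two_mul_nat', riemannZeta_two_mul_nat']
  have h : ∀ j : ℕ, (2 : ℂ) ^ (2 * (j : ℤ) - 1) = 2 ^ (2 * j) / 2 := fun j => by
    rw [zpow_sub_one₀ two_ne_zero, div_eq_mul_inv]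
    norm_cast
  rw [h, h]
  field_simp
  ring

/-- Ramanujan's formula for odd zeta values, as the transformation law of `nomeSeries`. -/
theorem nomeSeries_transform {N : ℕ} (hN : 1 ≤ N) {τ : ℂ} (hτ : 0 < τ.im) :
    nomeSeries (2 * N + 1) (Complex.exp (2 * Real.pi * Complex.I * τ)) =
      τ ^ (2 * N) * nomeSeries (2 * N + 1) (Complex.exp (2 * Real.pi * Complex.I * (-1 / τ))) -
        Complex.I * (2 * Real.pi) ^ (2 * N + 1) / (2 * N + 2).factorial * hPoly N τ := by
  have hτ0 : τ ≠ 0 := fun h => by simp [h] at hτ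
  have hpi : (Real.pi : ℂ) ≠ 0 := Complex.ofReal_ne_zero.2 Real.pi_ne_zero
  have hτ' : 0 < (-1 / τ).im := by
    rw [neg_div, one_div, Complex.neg_im, Complex.inv_im]
    have := Complex.normSq_pos.2 hτ0
    rw [neg_div, neg_neg]
    positivity
  have hP : ∀ m ∈ Finset.range (N + 2),
      τ ^ (2 * (m : ℤ) - 1) * (-(2 * (riemannZeta (2 * m) * riemannZeta (2 * (N + 1 - m : ℕ))))) =
      (2 * Real.pi) ^ (2 * N + 2) / (2 * (2 * N + 2).factorial) *
       ((-1) ^ N * (τ ^ (2 * (m : ℤ) - 1) * ((2 * N + 2).choose (2 * m) : ℂ) *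
        ((bernoulli (2 * m) : ℚ) : ℂ) * ((bernoulli (2 * N + 2 - 2 * m) : ℚ) : ℂ))) := by
    intro m hm
    have hm' : m ≤ N + 1 := by simpa [Nat.lt_succ_iff] using hm
    obtain ⟨l, hl⟩ := Nat.exists_eq_add_of_le hm'
    rw [show N + 1 - m = l by omega, show 2 * N + 2 - 2 * m = 2 * l by omega,
      zeta_two_mul_mul_zeta_two_mul, Nat.cast_choose ℂ (show 2 * m ≤ 2 * N + 2 by omega),
      show 2 * N + 2 - 2 * m = 2 * l by omega, ← hl,
      show 2 * m + 2 * l = 2 * N + 2 by omega]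
    have f1 : ((2 * m).factorial : ℂ) ≠ 0 := Nat.cast_ne_zero.2 (Nat.factorial_ne_zero _)
    have f2 : ((2 * l).factorial : ℂ) ≠ 0 := Nat.cast_ne_zero.2 (Nat.factorial_ne_zero _)
    have f3 : ((2 * N + 2).factorial : ℂ) ≠ 0 := Nat.cast_ne_zero.2 (Nat.factorial_ne_zero _)
    field_simp
    ring
  have hsum := Finset.sum_congr rfl hP
  rw [← Finset.mul_sum, ← Finset.mul_sum] at hsum
  have hH : hPoly N τ = -((-1) ^ N * ∑ m ∈ Finset.range (N + 2),
    τ ^ (2 * (m : ℤ) - 1) * ((2 * N + 2).choose (2 * m) : ℂ) *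
      ((bernoulli (2 * m) : ℚ) : ℂ) * ((bernoulli (2 * N + 2 - 2 * m) : ℚ) : ℂ)) := by
    rw [hPoly, pow_succ]
    ring
  rw [hH]
  have hsum2 : Complex.I / Real.pi * ∑ m ∈ Finset.range (N + 2),
      τ ^ (2 * (m : ℤ) - 1) * (-(2 * (riemannZeta (2 * m) * riemannZeta (2 * (N + 1 - m : ℕ))))) =
      Complex.I * (2 * Real.pi) ^ (2 * N + 1) / (2 * N + 2).factorial *
      ((-1) ^ N * ∑ m ∈ Finset.range (N + 2),
    τ ^ (2 * (m : ℤ) - 1) * ((2 * N + 2).choose (2 * m) : ℂ) *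
      ((bernoulli (2 * m) : ℚ) : ℂ) * ((bernoulli (2 * N + 2 - 2 * m) : ℚ) : ℂ)) := by
    rw [hsum]
    generalize (-1 : ℂ) ^ N * _ = Y
    have f3 : ((2 * N + 2).factorial : ℂ) ≠ 0 := Nat.cast_ne_zero.2 (Nat.factorial_ne_zero _)
    field_simp
    ring
  rw [mul_neg, sub_neg_eq_add, ← hsum2, nomeSeries_eq_quadraticDoubleSum hN hτ,
    nomeSeries_eq_quadraticDoubleSum hN hτ']
  have hD := quadraticDoubleSum_add 0 0 N hτ
  rw [zero_add, quadraticDoubleSum_swap N hτ0] at hD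
  -- The end terms of the Bernoulli sum contain ζ(0) = -1/2: the term m = 0 is ζ(2N+2)/τ, and m =
  -- N+1 cancels the matching term of the series at -1/τ.
  rw [hD, Finset.sum_range_succ, Finset.sum_range_succ']
  have hmid : ∑ i ∈ Finset.range N, τ ^ (2 * ((i + 1 : ℕ) : ℤ) - 1) *
      (-(2 * (riemannZeta (2 * (i + 1 : ℕ)) * riemannZeta (2 * (N + 1 - (i + 1) : ℕ))))) =
      -(2 * τ * ∑ i ∈ Finset.range N, τ ^ (2 * i) *
        (riemannZeta (2 * (N - i : ℕ)) * riemannZeta (2 * (0 + i + 1 : ℕ)))) := by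
    rw [Finset.mul_sum, ← Finset.sum_neg_distrib]
    refine Finset.sum_congr rfl fun i _ => ?_
    rw [show N + 1 - (i + 1) = N - i by omega, zero_add,
      show (2 * ((i + 1 : ℕ) : ℤ) - 1) = ((2 * i + 1 : ℕ) : ℤ) by push_cast; ring, zpow_natCast]
    ring
  rw [hmid]
  generalize ∑ i ∈ Finset.range N, τ ^ (2 * i) *
        (riemannZeta (2 * (N - i : ℕ)) * riemannZeta (2 * (0 + i + 1 : ℕ))) = Y
  rw [show (2 * ((N + 1 : ℕ) : ℤ) - 1) = ((2 * N + 1 : ℕ) : ℤ) by push_cast; ring, zpow_natCast,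
    Nat.sub_self, Nat.sub_zero]
  simp only [Nat.cast_zero, mul_zero, riemannZeta_zero, zero_sub, zpow_neg_one]
  field_simp
  ring

/-! ### Hecke relations and inversion on the upper half plane -/

/-- The series `nomeSeries` at the nome `exp (2πiτ)`. -/
noncomputable def eichlerSeries (k : ℕ) (τ : ℂ) : ℂ :=
  nomeSeries k (Complex.exp (2 * Real.pi * Complex.I * τ))

theorem eichlerSeries_add_nat (k : ℕ) (τ : ℂ) (j : ℕ) :
    eichlerSeries k (τ + j) = eichlerSeries k τ := by
  rw [eichlerSeries, eichlerSeries, mul_add, mul_comm _ (j : ℂ), Complex.exp_add,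
    Complex.exp_nat_mul_two_pi_mul_I, mul_one]

theorem norm_exp_two_pi_mul_I_lt_one {τ : ℂ} (hτ : 0 < τ.im) :
    ‖Complex.exp (2 * Real.pi * Complex.I * τ)‖ < 1 :=
  UpperHalfPlane.norm_exp_two_pi_I_lt_one ⟨τ, hτ⟩

theorem eichlerSeries_half {k : ℕ} (hk : 2 ≤ k) {τ : ℂ} (hτ : 0 < τ.im) :
    eichlerSeries k (τ / 2) + eichlerSeries k ((τ + 1) / 2) =
      2 * eichlerSeries k τ + 2 / 2 ^ k * (eichlerSeries k τ - eichlerSeries k (2 * τ)) := by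
  have hx : 0 < (τ / 2).im := by
    rw [Complex.div_ofNat_im]; positivity
  have h := nomeSeries_add_neg hk (norm_exp_two_pi_mul_I_lt_one hx)
  have e1 : -Complex.exp (2 * Real.pi * Complex.I * (τ / 2)) =
      Complex.exp (2 * Real.pi * Complex.I * ((τ + 1) / 2)) := by
    rw [show 2 * Real.pi * Complex.I * ((τ + 1) / 2) =
      2 * Real.pi * Complex.I * (τ / 2) + Real.pi * Complex.I by ring, Complex.exp_add,
      Complex.exp_pi_mul_I, mul_neg_one]
  have e2 : ((2 : ℕ) : ℂ) * (2 * Real.pi * Complex.I * (τ / 2)) = 2 * Real.pi * Complex.I * τ := by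
    push_cast; ring
  have e4 : ((4 : ℕ) : ℂ) * (2 * Real.pi * Complex.I * (τ / 2)) =
      2 * Real.pi * Complex.I * (2 * τ) := by
    push_cast; ring
  rwa [e1, ← Complex.exp_nat_mul, ← Complex.exp_nat_mul, e2, e4] at h

theorem eichlerSeries_third {k : ℕ} (hk : 2 ≤ k) {τ : ℂ} (hτ : 0 < τ.im) :
    eichlerSeries k (τ / 3) + eichlerSeries k ((τ + 1) / 3) + eichlerSeries k ((τ - 1) / 3) =
      3 * eichlerSeries k τ + 3 / 3 ^ k * (eichlerSeries k τ - eichlerSeries k (3 * τ)) := by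
  have hx : 0 < (τ / 3).im := by
    rw [Complex.div_ofNat_im]; positivity
  have hprim := Complex.isPrimitiveRoot_exp 3 three_ne_zero
  have hω : Complex.exp (2 * Real.pi * Complex.I / (3 : ℕ)) ^ 2 +
      Complex.exp (2 * Real.pi * Complex.I / (3 : ℕ)) + 1 = 0 := by
    have := hprim.geom_sum_eq_zero (by norm_num)
    rw [Finset.sum_range_succ, Finset.sum_range_succ, Finset.sum_range_one] at this
    linear_combination this
  have h := nomeSeries_cubeRoots hk (norm_exp_two_pi_mul_I_lt_one hx) hω
  have e2 : eichlerSeries k ((τ - 1) / 3) = eichlerSeries k ((τ + 2) / 3) := by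
    rw [← eichlerSeries_add_nat k ((τ - 1) / 3) 1]
    congr 1
    push_cast
    ring
  rw [e2]
  have e3 : ((3 : ℕ) : ℂ) * (2 * Real.pi * Complex.I * (τ / 3)) = 2 * Real.pi * Complex.I * τ := by
    push_cast; ring
  have e9 : ((9 : ℕ) : ℂ) * (2 * Real.pi * Complex.I * (τ / 3)) =
      2 * Real.pi * Complex.I * (3 * τ) := by
    push_cast; ring
  have f1 : 2 * Real.pi * Complex.I / (3 : ℕ) + 2 * Real.pi * Complex.I * (τ / 3) =
      2 * Real.pi * Complex.I * ((τ + 1) / 3) := by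
    push_cast; ring
  have f2 : ((2 : ℕ) : ℂ) * (2 * Real.pi * Complex.I / (3 : ℕ)) +
      2 * Real.pi * Complex.I * (τ / 3) = 2 * Real.pi * Complex.I * ((τ + 2) / 3) := by
    push_cast; ring
  simp only [← Complex.exp_nat_mul, ← Complex.exp_add] at h
  rwa [e3, e9, f1, f2] at h

theorem eichlerSeries_transform {N : ℕ} (hN : 1 ≤ N) {τ : ℂ} (hτ : 0 < τ.im) :
    eichlerSeries (2 * N + 1) τ = τ ^ (2 * N) * eichlerSeries (2 * N + 1) (-1 / τ) -
      Complex.I * (2 * Real.pi) ^ (2 * N + 1) / (2 * N + 2).factorial * hPoly N τ :=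
  nomeSeries_transform hN hτ

/-! ### Period values in ℚ(√-3) -/

theorem sqrtNegThree_sq : sqrtNegThree ^ 2 = -3 := by
  rw [sqrtNegThree, mul_pow, Complex.I_sq, ← Complex.ofReal_pow, Real.sq_sqrt (by norm_num)]
  norm_num

theorem sqrtNegThree_im : sqrtNegThree.im = Real.sqrt 3 := by simp [sqrtNegThree]

theorem sqrtNegThree_ne_zero : sqrtNegThree ≠ 0 := fun h => by
  have := sqrtNegThree_sq
  rw [h] at this
  norm_num at this

theorem conj_sqrtNegThree : (starRingEnd ℂ) sqrtNegThree = -sqrtNegThree := by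
  simp [sqrtNegThree]

theorem conj_hPoly (N : ℕ) (z : ℂ) :
    (starRingEnd ℂ) (hPoly N z) = hPoly N ((starRingEnd ℂ) z) := by
  simp [hPoly, map_sum, map_zpow₀]

theorem hPoly_neg (N : ℕ) (z : ℂ) : hPoly N (-z) = -hPoly N z := by
  rw [hPoly, hPoly, ← mul_neg, ← Finset.sum_neg_distrib]
  congr 1
  refine Finset.sum_congr rfl fun m _ => ?_
  have : Odd (2 * (m : ℤ) - 1) := ⟨m - 1, by ring⟩
  rw [this.neg_zpow]
  ring

/-- The period contribution of the three points `√-3 / 3`, `(√-3 ± 1) / 3`. -/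
theorem hPoly_add_hPoly_add_hPoly (N : ℕ) :
    hPoly N (sqrtNegThree / 3) + hPoly N ((sqrtNegThree + 1) / 3) +
        hPoly N ((sqrtNegThree - 1) / 3) =
      Complex.I * ((2 * hPoly N ((1 + sqrtNegThree) / 3) +
        hPoly N (sqrtNegThree / 3)).im : ℝ) := by
  have c3 : (starRingEnd ℂ) (3 : ℂ) = 3 := map_ofNat _ 3
  have h1 : hPoly N ((sqrtNegThree - 1) / 3) =
      -(starRingEnd ℂ) (hPoly N ((1 + sqrtNegThree) / 3)) := by
    rw [conj_hPoly, ← hPoly_neg, map_div₀, map_add, map_one, conj_sqrtNegThree, c3]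
    congr 1
    ring
  have h2 : hPoly N (sqrtNegThree / 3) = -(starRingEnd ℂ) (hPoly N (sqrtNegThree / 3)) := by
    rw [conj_hPoly, ← hPoly_neg, map_div₀, conj_sqrtNegThree, c3]
    congr 1
    ring
  have h3 : (hPoly N (sqrtNegThree / 3)).re = 0 := by
    have := congrArg Complex.re h2
    rw [Complex.neg_re, Complex.conj_re] at this
    linarith
  rw [h1, add_comm sqrtNegThree 1]
  apply Complex.ext
  · simp [h3]
  · simp
    ring

/-- The field `ℚ(√-3)` as a subring of `ℂ`. -/
noncomputable def ratSqrtNegThree : Subring ℂ where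
  carrier := {z | ∃ x y : ℚ, z = x + y * sqrtNegThree}
  mul_mem' := by
    rintro _ _ ⟨x, y, rfl⟩ ⟨x', y', rfl⟩
    refine ⟨x * x' - 3 * (y * y'), x * y' + y * x', ?_⟩
    push_cast
    linear_combination (y * y' : ℂ) * sqrtNegThree_sq
  one_mem' := ⟨1, 0, by simp⟩
  add_mem' := by
    rintro _ _ ⟨x, y, rfl⟩ ⟨x', y', rfl⟩
    exact ⟨x + x', y + y', by push_cast; ring⟩
  zero_mem' := ⟨0, 0, by simp⟩
  neg_mem' := by
    rintro _ ⟨x, y, rfl⟩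
    exact ⟨-x, -y, by push_cast; ring⟩

theorem ratCast_mem_ratSqrtNegThree (x : ℚ) : (x : ℂ) ∈ ratSqrtNegThree := ⟨x, 0, by simp⟩

/-- The inverse is needed for the term m = 0, which has exponent -1. -/
theorem hPoly_mem_ratSqrtNegThree (N : ℕ) {z : ℂ} (hz : z ∈ ratSqrtNegThree)
    (hz' : z⁻¹ ∈ ratSqrtNegThree) : hPoly N z ∈ ratSqrtNegThree := by
  refine mul_mem (pow_mem (neg_mem (one_mem _)) _) (sum_mem fun m _ => ?_)
  refine mul_mem (mul_mem (mul_mem ?_ (natCast_mem _ _)) (ratCast_mem_ratSqrtNegThree _))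
    (ratCast_mem_ratSqrtNegThree _)
  rcases m with _ | m
  · simpa using hz'
  · rw [show 2 * ((m + 1 : ℕ) : ℤ) - 1 = ((2 * m + 1 : ℕ) : ℤ) by push_cast; ring, zpow_natCast]
    exact pow_mem hz _

/-- This is what makes the coefficient of √3 π^k rational. -/
theorem exists_im_hPoly_eq (N : ℕ) :
    ∃ y : ℚ, (2 * hPoly N ((1 + sqrtNegThree) / 3) + hPoly N (sqrtNegThree / 3)).im =
      y * Real.sqrt 3 := by
  have hs := sqrtNegThree_sq
  have hs0 := sqrtNegThree_ne_zero
  have h1s : 1 + sqrtNegThree ≠ 0 := fun h => by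
    have h' : sqrtNegThree = -1 := by linear_combination h
    rw [h'] at hs
    norm_num at hs
  have m1 : hPoly N ((1 + sqrtNegThree) / 3) ∈ ratSqrtNegThree := by
    refine hPoly_mem_ratSqrtNegThree N ⟨1 / 3, 1 / 3, by push_cast; ring⟩ ⟨3 / 4, -3 / 4, ?_⟩
    push_cast
    rw [inv_div, div_eq_iff h1s]
    linear_combination (3 / 4 : ℂ) * hs
  have m2 : hPoly N (sqrtNegThree / 3) ∈ ratSqrtNegThree := by
    refine hPoly_mem_ratSqrtNegThree N ⟨0, 1 / 3, by push_cast; ring⟩ ⟨0, -1, ?_⟩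
    push_cast
    rw [inv_div, div_eq_iff hs0]
    linear_combination hs
  obtain ⟨x, y, h⟩ := add_mem (mul_mem (ofNat_mem ratSqrtNegThree 2) m1) m2
  refine ⟨y, ?_⟩
  rw [h, Complex.add_im, ← Complex.ofReal_ratCast, ← Complex.ofReal_ratCast,
    Complex.im_ofReal_mul, sqrtNegThree_im, Complex.ofReal_im, zero_add]

/-! ### The relation between values at multiples of √-3 -/

/-- The relation between the values at `√-3`, `3√-3/2`, `3√-3` and `6√-3` that follows from the
Hecke relations for the primes `2` and `3` and the transformation law. -/
theorem eichlerSeries_relation {n : ℕ} (hn : 1 ≤ n) :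
    2 ^ (6 * n) * (3 ^ (6 * n + 1) - (-3) ^ (3 * n) + 1) * eichlerSeries (6 * n + 1) sqrtNegThree =
      (2 ^ (6 * n + 1) + 1) * ((2 ^ (6 * n + 1) + 1) * eichlerSeries (6 * n + 1) (3 * sqrtNegThree) -
        eichlerSeries (6 * n + 1) (6 * sqrtNegThree) -
        2 ^ (6 * n) * eichlerSeries (6 * n + 1) (3 * sqrtNegThree / 2)) +
      2 ^ (6 * n) * 3 ^ (6 * n) * ((2 * Real.pi) ^ (6 * n + 1) / (6 * n + 2).factorial *
        ((2 * hPoly (3 * n) ((1 + sqrtNegThree) / 3) +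
          hPoly (3 * n) (sqrtNegThree / 3)).im : ℝ)) := by
  have hs := sqrtNegThree_sq
  have him := sqrtNegThree_im
  have hH := hPoly_add_hPoly_add_hPoly (3 * n)
  have h3 : (0 : ℝ) < Real.sqrt 3 := by positivity
  generalize ((2 * hPoly (3 * n) ((1 + sqrtNegThree) / 3) +
          hPoly (3 * n) (sqrtNegThree / 3)).im : ℝ) = h at *
  have hk : 2 ≤ 6 * n + 1 := by omega
  have hs0 := sqrtNegThree_ne_zero
  generalize sqrtNegThree = s at *
  have i0 : 0 < s.im := by rw [him]; exact h3
  have i1 : 0 < (s / 3).im := by rw [Complex.div_ofNat_im]; positivity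
  have i2 : 0 < ((s + 1) / 3).im := by
    rw [Complex.div_ofNat_im, Complex.add_im, Complex.one_im, add_zero]; positivity
  have i3 : 0 < ((s - 1) / 3).im := by
    rw [Complex.div_ofNat_im, Complex.sub_im, Complex.one_im, sub_zero]; positivity
  have i4 : 0 < (3 * s).im := by
    rw [Complex.mul_im]; simpa using i0
  have i5 : 0 < ((3 * s + 3) / 2).im := by
    rw [Complex.div_ofNat_im, Complex.add_im, Complex.im_ofNat, add_zero]; positivity
  have t1 := eichlerSeries_transform (N := 3 * n) (by omega) i1
  have t2 := eichlerSeries_transform (N := 3 * n) (by omega) i2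
  have t3 := eichlerSeries_transform (N := 3 * n) (by omega) i3
  rw [show 2 * (3 * n) = 6 * n by ring] at t1 t2 t3
  have a4 := eichlerSeries_third hk i0
  have a5 := eichlerSeries_half hk i5
  have a6 := eichlerSeries_half hk i4
  have hp1 : s + 1 ≠ 0 := fun h' => by
    have h' : s = -1 := by linear_combination h'
    rw [h'] at hs
    norm_num at hs
  have hm1 : s - 1 ≠ 0 := fun h' => by
    have h' : s = 1 := by linear_combination h'
    rw [h'] at hs
    norm_num at hs
  -- Inversion uses s² = -3 and (s+1)(s-1) = -4. The images of (s+1)/3 (after adding 2) and (s-1)/3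
  -- are the two points in the relation at 2 for (3s+3)/2.
  have p1 : -1 / (s / 3) = s := by
    field_simp
    linear_combination -hs
  have p2 : -1 / ((s + 1) / 3) + (2 : ℕ) = ((3 * s + 3) / 2 + 1) / 2 := by
    push_cast
    field_simp
    linear_combination -3 * hs
  have p3 : -1 / ((s - 1) / 3) = (3 * s + 3) / 2 / 2 := by
    field_simp
    linear_combination -hs
  have p5 : 2 * ((3 * s + 3) / 2) = 3 * s + (3 : ℕ) := by push_cast; ring
  have p6 : (3 * s + 3) / 2 = (3 * s + 1) / 2 + (1 : ℕ) := by push_cast; ring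
  rw [p1] at t1
  rw [← eichlerSeries_add_nat _ (-1 / ((s + 1) / 3)) 2, p2] at t2
  rw [p3] at t3
  rw [p5, eichlerSeries_add_nat] at a5
  rw [← eichlerSeries_add_nat _ ((3 * s + 1) / 2) 1, ← p6,
    show 2 * (3 * s) = 6 * s by ring] at a6
  have w1 : (s / 3) ^ (6 * n) * 3 ^ (6 * n) = (-3) ^ (3 * n) := by
    rw [← mul_pow, div_mul_cancel₀ _ three_ne_zero, show 6 * n = 2 * (3 * n) by ring, pow_mul, hs]
  -- (s±1)/2 are sixth roots of unity; the cofactors below are the quotients of (s±1)⁶ - 64 by s² +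
  -- 3.
  have w2 : ((s + 1) / 3) ^ (6 * n) * 3 ^ (6 * n) = 2 ^ (6 * n) := by
    rw [← mul_pow, div_mul_cancel₀ _ three_ne_zero, pow_mul, pow_mul]
    congr 1
    linear_combination (s ^ 4 + 6 * s ^ 3 + 12 * s ^ 2 + 2 * s - 21) * hs
  have w3 : ((s - 1) / 3) ^ (6 * n) * 3 ^ (6 * n) = 2 ^ (6 * n) := by
    rw [← mul_pow, div_mul_cancel₀ _ three_ne_zero, pow_mul, pow_mul]
    congr 1
    linear_combination (s ^ 4 - 6 * s ^ 3 + 12 * s ^ 2 - 2 * s - 21) * hs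
  have hr : (3 : ℂ) ^ (6 * n) ≠ 0 := pow_ne_zero _ three_ne_zero
  have ht : (2 : ℂ) ^ (6 * n) ≠ 0 := pow_ne_zero _ two_ne_zero
  rw [pow_succ (3 : ℂ), div_mul_cancel_right₀ three_ne_zero] at a4
  rw [pow_succ (2 : ℂ), div_mul_cancel_right₀ two_ne_zero] at a5 a6
  have hri := mul_inv_cancel₀ hr
  have hti := mul_inv_cancel₀ ht
  rw [pow_succ (3 : ℂ), pow_succ (2 : ℂ)]
  have hI := Complex.I_sq
  generalize (2 * Real.pi : ℂ) ^ (6 * n + 1) = C at *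
  generalize ((6 * n + 2).factorial : ℂ) = D at *
  generalize (3 : ℂ) ^ (6 * n) = r at *
  generalize (2 : ℂ) ^ (6 * n) = t at *
  generalize ((-3 : ℂ)) ^ (3 * n) = g at *
  have A : r * (eichlerSeries (6 * n + 1) (s / 3) + eichlerSeries (6 * n + 1) ((s + 1) / 3) +
      eichlerSeries (6 * n + 1) ((s - 1) / 3)) =
      (3 * r + 1) * eichlerSeries (6 * n + 1) s - eichlerSeries (6 * n + 1) (3 * s) := by
    rw [a4]
    linear_combination (eichlerSeries (6 * n + 1) s - eichlerSeries (6 * n + 1) (3 * s)) * hri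
  have B : r * (eichlerSeries (6 * n + 1) (s / 3) + eichlerSeries (6 * n + 1) ((s + 1) / 3) +
      eichlerSeries (6 * n + 1) ((s - 1) / 3)) =
      g * eichlerSeries (6 * n + 1) s + t * (eichlerSeries (6 * n + 1) ((3 * s + 3) / 2 / 2) +
        eichlerSeries (6 * n + 1) (((3 * s + 3) / 2 + 1) / 2)) + r * (C / D * h) := by
    rw [t1, t2, t3, ← w1, ← w2]
    linear_combination (eichlerSeries (6 * n + 1) ((3 * s + 3) / 2 / 2)) * (w3 - w2) -
      r * (Complex.I * C / D) * hH - r * (C / D) * h * hI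
  have Cc : t * (eichlerSeries (6 * n + 1) ((3 * s + 3) / 2 / 2) +
        eichlerSeries (6 * n + 1) (((3 * s + 3) / 2 + 1) / 2)) =
      (2 * t + 1) * eichlerSeries (6 * n + 1) ((3 * s + 3) / 2) -
        eichlerSeries (6 * n + 1) (3 * s) := by
    rw [a5]
    linear_combination (eichlerSeries (6 * n + 1) ((3 * s + 3) / 2) -
      eichlerSeries (6 * n + 1) (3 * s)) * hti
  have Dd : t * (eichlerSeries (6 * n + 1) (3 * s / 2) +
        eichlerSeries (6 * n + 1) ((3 * s + 3) / 2)) =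
      (2 * t + 1) * eichlerSeries (6 * n + 1) (3 * s) -
        eichlerSeries (6 * n + 1) (6 * s) := by
    rw [a6]
    linear_combination (eichlerSeries (6 * n + 1) (3 * s) -
      eichlerSeries (6 * n + 1) (6 * s)) * hti
  -- `A` and `B` evaluate the same sum, by the relation at 3 and by inversion; `Cc` removes the two
  -- halves of (3s+3)/2, and `Dd` removes (3s+3)/2 itself.
  linear_combination t * (B - A) + t * Cc + (2 * t + 1) * Dd

/-! ### Return to real Lambert series -/

theorem summable_lambertTerm {k : ℕ} (hk : 2 ≤ k) {q : ℝ} (hq0 : 0 < q) (hq1 : q < 1) :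
    Summable fun m : ℕ => lambertTerm k q (m + 1) := by
  have hs : Summable fun m : ℕ => 1 / ((m + 1 : ℕ) : ℝ) ^ k * (1 / (1 - q)) :=
    ((summable_nat_add_iff 1).2 (Real.summable_one_div_nat_pow.2 hk)).mul_right _
  have hle : ∀ m : ℕ, q ^ (m + 1) ≤ q := fun m => pow_le_of_le_one hq0.le hq1.le (by omega)
  refine Summable.of_nonneg_of_le (fun m => ?_) (fun m => ?_) hs
  · have : 0 < 1 - q ^ (m + 1) := by linarith [hle m]
    unfold lambertTerm
    positivity
  · have h := hle m
    have h1 : 0 < 1 - q := by linarith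
    unfold lambertTerm
    gcongr
    linarith

theorem nomeSeries_ofReal {k : ℕ} (hk : 2 ≤ k) {q : ℝ} (hq0 : 0 < q) (hq1 : q < 1) :
    nomeSeries k (q : ℂ) = riemannZeta k + 2 * (lambertS k q : ℂ) := by
  have hq : ‖(q : ℂ)‖ < 1 := by
    rwa [Complex.norm_real, Real.norm_of_nonneg hq0.le]
  have h1 := (hasSum_nat_add_iff' 1).2 (summable_nomeSeries hk hq).hasSum
  have hz : HasSum (fun m : ℕ => 1 / ((m + 1 : ℕ) : ℂ) ^ k) (riemannZeta k) := by
    have hs : Summable fun m : ℕ => 1 / (m : ℂ) ^ k :=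
      .of_norm <| by simpa using Real.summable_one_div_nat_pow.2 hk
    rw [zeta_nat_eq_tsum_of_gt_one (by omega)]
    have hk0 : k ≠ 0 := by omega
    simpa [hk0] using (hasSum_nat_add_iff' 1).2 hs.hasSum
  have h2 : HasSum (fun m : ℕ => (lambertTerm k q (m + 1) : ℂ)) (lambertS k q : ℂ) :=
    Complex.hasSum_ofReal.2 (summable_lambertTerm hk hq0 hq1).hasSum
  have h3 := (hz.add (h2.mul_left 2)).tsum_eq
  have h4 := h1.tsum_eq
  simp only [Finset.range_one, Finset.sum_singleton, pow_zero, sub_self, div_zero, mul_zero,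
    sub_zero] at h4
  rw [nomeSeries, ← h4, ← h3]
  refine tsum_congr fun m => ?_
  have h5 := one_sub_pow_ne_zero_of_norm_lt_one hq (Nat.succ_ne_zero m)
  rw [Nat.succ_eq_add_one] at h5
  rw [lambertTerm]
  push_cast
  field_simp
  ring

theorem q3_pos : 0 < q3 := Real.exp_pos _

theorem q3_lt_one : q3 < 1 := by
  rw [q3, Real.exp_lt_one_iff]
  have : 0 < Real.pi * Real.sqrt 3 := by positivity
  linarith

theorem q3_pow (d : ℕ) : q3 ^ d = Real.exp (-(Real.pi * Real.sqrt (3 * (d : ℝ) ^ 2))) := by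
  rw [q3, ← Real.exp_nat_mul, Real.sqrt_mul (by norm_num), Real.sqrt_sq (by positivity)]
  congr 1
  ring

/-- The condition on 2τ makes the nome q₃^d and admits odd d, as needed at 3√-3/2. -/
theorem eichlerSeries_half_mul_sqrtNegThree {k d : ℕ} (hk : 2 ≤ k) (hd : d ≠ 0) {τ : ℂ}
    (hτ : 2 * τ = d * sqrtNegThree) :
    eichlerSeries k τ = riemannZeta k + 2 * (lambertS k (q3 ^ d) : ℂ) := by
  rw [← nomeSeries_ofReal hk (pow_pos q3_pos d) (pow_lt_one₀ q3_pos.le q3_lt_one hd),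
    eichlerSeries, q3]
  congr 1
  push_cast
  rw [← Complex.exp_nat_mul]
  congr 1
  rw [sqrtNegThree] at hτ
  linear_combination (Real.pi * Complex.I) * hτ +
    (d * Real.pi * (Real.sqrt 3 : ℂ)) * Complex.I_sq

/-! ### Merit -/

theorem tendsto_one_sub_pow_succ {q : ℝ} (hq0 : 0 < q) (hq1 : q < 1) :
    Tendsto (fun m : ℕ => 1 - q ^ (m + 1)) atTop (𝓝 1) := by
  have := ((tendsto_pow_atTop_nhds_zero_of_lt_one hq0.le hq1).comp (tendsto_add_atTop_nat 1))
  simpa using this.const_sub 1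

theorem lambertTerm_pos {k : ℕ} {q : ℝ} (hq0 : 0 < q) (hq1 : q < 1) (m : ℕ) :
    0 < lambertTerm k q (m + 1) := by
  have : 0 < 1 - q ^ (m + 1) := sub_pos.2 (pow_lt_one₀ hq0.le hq1 (by omega))
  unfold lambertTerm
  positivity

theorem tendsto_lambertTerm_ratio (k : ℕ) {q : ℝ} (hq0 : 0 < q) (hq1 : q < 1) :
    Tendsto (fun m : ℕ => lambertTerm k q (m + 1 + 1) / lambertTerm k q (m + 1)) atTop (𝓝 q) := by
  have h1 := tendsto_one_sub_pow_succ hq0 hq1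
  have h2 : Tendsto (fun m : ℕ => (((m + 1 : ℕ) : ℝ) / ((m + 1 : ℕ) + 1)) ^ k) atTop (𝓝 1) := by
    simpa using ((tendsto_natCast_div_add_atTop (1 : ℝ)).comp (tendsto_add_atTop_nat 1)).pow k
  have h3 := (h2.mul_const q).mul (h1.div (h1.comp (tendsto_add_atTop_nat 1)) one_ne_zero)
  rw [one_mul, div_one, mul_one] at h3
  refine h3.congr fun m => ?_
  have e1 : 1 - q ^ (m + 1) ≠ 0 := (sub_pos.2 (pow_lt_one₀ hq0.le hq1 (by omega))).ne'
  have e2 : 1 - q ^ (m + 1 + 1) ≠ 0 := (sub_pos.2 (pow_lt_one₀ hq0.le hq1 (by omega))).ne'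
  simp only [lambertTerm, Function.comp_apply, Pi.div_apply, div_pow]
  have e3 : ((m + 1 : ℕ) : ℝ) ≠ 0 := by positivity
  have e4 : ((m + 1 : ℕ) : ℝ) + 1 ≠ 0 := by positivity
  rw [Nat.cast_add_one (m + 1), pow_succ q (m + 1)] at *
  field_simp

theorem tendsto_lambertTerm_div_zero (k : ℕ) {p q : ℝ} (hp : 0 < p) (hpq : p < q) (hq : q < 1) :
    Tendsto (fun m : ℕ => lambertTerm k p (m + 1) / lambertTerm k q (m + 1)) atTop (𝓝 0) := by
  have hq0 := hp.trans hpq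
  have h1 := (tendsto_one_sub_pow_succ hq0 hq).div
    (tendsto_one_sub_pow_succ hp (hpq.trans hq)) one_ne_zero
  have h2 := (tendsto_pow_atTop_nhds_zero_of_lt_one (r := p / q) (by positivity)
    ((div_lt_one hq0).2 hpq)).comp (tendsto_add_atTop_nat 1)
  have h3 := h2.mul h1
  rw [zero_mul] at h3
  refine h3.congr fun m => ?_
  have e1 : 1 - q ^ (m + 1) ≠ 0 := (sub_pos.2 (pow_lt_one₀ hq0.le hq (by omega))).ne'
  have e2 : 1 - p ^ (m + 1) ≠ 0 :=
    (sub_pos.2 (pow_lt_one₀ hp.le (hpq.trans hq) (by omega))).ne'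
  have e3 : ((m + 1 : ℕ) : ℝ) ≠ 0 := by positivity
  simp only [lambertTerm, Function.comp_apply, Pi.div_apply, div_pow]
  field_simp

/-- Merit depends only on the terms up to asymptotic equivalence and a nonzero constant. -/
theorem HasMerit.of_tendsto_div {u w : ℕ → ℝ} {a c : ℝ} (hu : HasMerit u a) (hu0 : ∀ m, u m ≠ 0)
    (hc : c ≠ 0) (h : Tendsto (fun m => w m / u m) atTop (𝓝 c)) : HasMerit w a := by
  have h1 := ((h.comp (tendsto_add_atTop_nat 1)).mul hu).div h hc
  rw [mul_div_cancel_left₀ _ hc] at h1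
  refine h1.congr fun m => ?_
  simp only [Function.comp, Pi.div_apply]
  rw [div_mul_div_cancel₀ (hu0 _), div_div_div_cancel_right₀ (hu0 m)]

theorem hasMerit_lambertTerm (k : ℕ) {d : ℕ} (hd : d ≠ 0) :
    HasMerit (fun m : ℕ => lambertTerm k (q3 ^ d) (m + 1)) (3 * (d : ℝ) ^ 2) := by
  rw [HasMerit, ← q3_pow]
  exact tendsto_lambertTerm_ratio k (pow_pos q3_pos d) (pow_lt_one₀ q3_pos.le q3_lt_one hd)

/-- Relative to the terms at q₃², those at the smaller nomes tend to 0, so the combination behaves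
like c₂ times the series at q₃². -/
theorem hasMerit_combination (k : ℕ) (c : ℕ → ℝ) (hc : c 2 ≠ 0) :
    HasMerit (fun m : ℕ => ∑ d ∈ ({2, 3, 6, 12} : Finset ℕ),
      c d * lambertTerm k (q3 ^ d) (m + 1)) 12 := by
  have h2 := hasMerit_lambertTerm k two_ne_zero
  rw [show (3 * ((2 : ℕ) : ℝ) ^ 2) = 12 by norm_num] at h2
  have hpos : ∀ m, lambertTerm k (q3 ^ 2) (m + 1) ≠ 0 := fun m =>
    (lambertTerm_pos (pow_pos q3_pos 2) (pow_lt_one₀ q3_pos.le q3_lt_one two_ne_zero) m).ne'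
  have hz : ∀ d, 2 < d → Tendsto (fun m : ℕ => c d * (lambertTerm k (q3 ^ d) (m + 1) /
      lambertTerm k (q3 ^ 2) (m + 1))) atTop (𝓝 0) := fun d hd => by
    have := (tendsto_lambertTerm_div_zero k (pow_pos q3_pos d)
      (pow_lt_pow_right_of_lt_one₀ q3_pos q3_lt_one hd)
      (pow_lt_one₀ q3_pos.le q3_lt_one two_ne_zero)).const_mul (c d)
    rwa [mul_zero] at this
  refine h2.of_tendsto_div hpos hc ?_
  have h := (((hz 3 (by norm_num)).add (hz 6 (by norm_num))).add (hz 12 (by norm_num))).const_add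
    (c 2)
  simp only [add_zero] at h
  refine h.congr fun m => ?_
  have := hpos m
  simp
  field_simp
  ring

/-! ### Properties of e_n and assembly of the theorem -/

theorem eSeq_pos {n : ℕ} (hn : 1 ≤ n) : 0 < eSeq n := by
  have h1 : (27 : ℚ) ^ n ≤ 729 ^ n := by gcongr; norm_num
  have h2 : (64 : ℚ) ^ n < 729 ^ n := by
    apply pow_lt_pow_left₀ (by norm_num) (by norm_num) (by omega)
  have h3 : (-27 : ℚ) ^ n ≤ 27 ^ n := by
    rw [neg_pow]
    rcases neg_one_pow_eq_or ℚ n with h | h <;> rw [h] <;> simp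
  rw [eSeq, pow_succ, pow_mul, pow_mul, pow_mul]
  norm_num
  linarith

theorem exists_eSeq_eq (n : ℕ) : ∃ j : ℤ, eSeq n = 7 * j := by
  -- Modulo 14 both 729 and -27 are 1, and 2 · 64^n is 2, so the expression is 3 - 1 - 2 = 0; the
  -- extra 2 absorbs the halving in e_n.
  have h14 : (14 : ℤ) ∣ 729 ^ n * 3 - (-27) ^ n - 2 * 64 ^ n := by
    have a : (729 : ℤ) ^ n ≡ 1 [ZMOD 14] := by
      simpa using (show (729 : ℤ) ≡ 1 [ZMOD 14] by decide).pow n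
    have b : (-27 : ℤ) ^ n ≡ 1 [ZMOD 14] := by
      simpa using (show (-27 : ℤ) ≡ 1 [ZMOD 14] by decide).pow n
    have c : (64 : ℤ) ^ n ≡ 1 [ZMOD 7] := by
      simpa using (show (64 : ℤ) ≡ 1 [ZMOD 7] by decide).pow n
    have a' := a.dvd
    have b' := b.dvd
    have c' := c.dvd
    omega
  obtain ⟨j, hj⟩ := h14
  refine ⟨j, ?_⟩
  have hj' : (729 : ℚ) ^ n * 3 - (-27) ^ n - 2 * 64 ^ n = 14 * j := by exact_mod_cast hj
  rw [eSeq, pow_succ, pow_mul, pow_mul, pow_mul]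
  norm_num
  linarith

theorem riemannZeta_eq_lambertS {n : ℕ} (hn : 1 ≤ n) {y : ℚ}
    (hy : (2 * hPoly (3 * n) ((1 + sqrtNegThree) / 3) + hPoly (3 * n) (sqrtNegThree / 3)).im =
      y * Real.sqrt 3) :
    riemannZeta ((6 * n + 1 : ℕ) : ℂ) =
      ((((2 ^ (6 * n) * 3 ^ (6 * n) * y / ((6 * n + 2).factorial * eSeq n) : ℚ) : ℝ) *
          Real.sqrt 3 * Real.pi ^ (6 * n + 1) +
        (((-(fSeq n / eSeq n) - 2 : ℚ) : ℝ) * lambertS (6 * n + 1) (q3 ^ 2) +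
        (((-(fSeq n / eSeq n) : ℚ) : ℝ) * lambertS (6 * n + 1) (q3 ^ 3) +
        (((fSeq n * (fSeq n / eSeq n) / 2 ^ (6 * n) : ℚ) : ℝ) * lambertS (6 * n + 1) (q3 ^ 6) +
        ((-(fSeq n / eSeq n) / 2 ^ (6 * n) : ℚ) : ℝ) * lambertS (6 * n + 1) (q3 ^ 12)))) : ℝ) :
          ℂ) := by
  have h := eichlerSeries_relation hn
  have hk : 2 ≤ 6 * n + 1 := by omega
  rw [hy, eichlerSeries_half_mul_sqrtNegThree (d := 2) hk (by norm_num) (by push_cast; ring),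
    eichlerSeries_half_mul_sqrtNegThree (d := 6) hk (by norm_num)
      (τ := 3 * sqrtNegThree) (by push_cast; ring),
    eichlerSeries_half_mul_sqrtNegThree (d := 12) hk (by norm_num)
      (τ := 6 * sqrtNegThree) (by push_cast; ring),
    eichlerSeries_half_mul_sqrtNegThree (d := 3) hk (by norm_num)
      (τ := 3 * sqrtNegThree / 2) (by push_cast; ring)] at h
  have he : (eSeq n : ℂ) ≠ 0 := Rat.cast_ne_zero.2 (eSeq_pos hn).ne'
  have hf : (fSeq n : ℂ) = 2 ^ (6 * n + 1) + 1 := by rw [fSeq]; push_cast; ring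
  -- With t = 2^(6n) and f = 2t + 1, the copies of ζ(k) total t(2e + f) - f(f - 1 - t) = 2te.
  have he2 : (3 : ℂ) ^ (6 * n + 1) - (-3) ^ (3 * n) + 1 = 2 * eSeq n + fSeq n := by
    rw [hf, eSeq]; push_cast; ring
  rw [he2, ← hf, mul_pow, pow_succ (2 : ℂ)] at h
  rw [pow_succ (2 : ℂ)] at hf
  have ht : (2 : ℂ) ^ (6 * n) ≠ 0 := pow_ne_zero _ two_ne_zero
  have hD : ((6 * n + 2).factorial : ℂ) ≠ 0 := Nat.cast_ne_zero.2 (Nat.factorial_ne_zero _)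
  push_cast at h ⊢
  generalize (2 : ℂ) ^ (6 * n) = t at *
  generalize (3 : ℂ) ^ (6 * n) = r at *
  generalize ((6 * n + 2).factorial : ℂ) = D at *
  generalize (eSeq n : ℂ) = e at *
  generalize (lambertS (6 * n + 1) (q3 ^ 2) : ℂ) = S2 at *
  generalize (lambertS (6 * n + 1) (q3 ^ 3) : ℂ) = S3 at *
  generalize (lambertS (6 * n + 1) (q3 ^ 6) : ℂ) = S6 at *
  generalize (lambertS (6 * n + 1) (q3 ^ 12) : ℂ) = S12 at *
  generalize riemannZeta (6 * (n : ℂ) + 1) = Z at *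
  generalize (fSeq n : ℂ) = f at *
  field_simp at h ⊢
  linear_combination (1 / 2) * h + (Z * D * f / 2) * hf

theorem normalizedCoeff_eq {n : ℕ} (hn : 1 ≤ n) {y : ℚ} {h : ℝ} (hy : h = y * Real.sqrt 3) :
    ((normalizedCoeff n (2 ^ (6 * n) * 3 ^ (6 * n) * y / ((6 * n + 2).factorial * eSeq n)) : ℚ) :
      ℝ) = 48 * (2 * n + 1) * (3 * n + 2) * 3 ^ (6 * n) /
            ((3 * n + 1) * (6 * n + 1) * Real.sqrt 3) * h := by
  have h3 : Real.sqrt 3 ≠ 0 := by positivity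
  have he : (eSeq n : ℝ) ≠ 0 := Rat.cast_ne_zero.2 (eSeq_pos hn).ne'
  -- The truncated exponent 6n - 4 is genuine because n ≥ 1.
  have ht : (2 : ℝ) ^ (6 * n) = 2 ^ (6 * n - 4) * 16 := by
    rw [show (16 : ℝ) = 2 ^ 4 by norm_num, ← pow_add]
    congr 1
    omega
  rw [hy, normalizedCoeff, Nat.factorial_succ, Nat.factorial_succ]
  have hD : ((6 * n).factorial : ℝ) ≠ 0 := Nat.cast_ne_zero.2 (Nat.factorial_ne_zero _)
  push_cast
  rw [ht]
  have h61 : (6 * (n : ℝ) + 1) ≠ 0 := by positivity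
  have h31 : (3 * (n : ℝ) + 1) ≠ 0 := by positivity
  have h62 : (6 * (n : ℝ) + 1 + 1) = 2 * (3 * n + 1) := by ring
  rw [h62]
  field_simp
  ring

theorem mainTheorem5 :
    ∃ E : ℕ → ℕ → ℚ, ∀ n k : ℕ, 1 ≤ n → k = 6 * n + 1 →
      -- `e_n` is a positive integer divisible by `7`
      (0 < eSeq n ∧ ∃ j : ℤ, eSeq n = 7 * j) ∧
      -- the coefficients of the Lambert series
      (E k 2 + 2 = -(fSeq n / eSeq n) ∧
        E k 3 = -(fSeq n / eSeq n) ∧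
        2 ^ (6 * n) * E k 12 = -(fSeq n / eSeq n) ∧
        E k 6 = -(fSeq n * E k 12)) ∧
      -- the coefficient of `√3 π ^ k`
      ((normalizedCoeff n (E k 0) : ℚ) : ℝ) =
        48 * (2 * n + 1) * (3 * n + 2) * 3 ^ (6 * n) /
            ((3 * n + 1) * (6 * n + 1) * Real.sqrt 3) *
          (2 * hPoly (3 * n) ((1 + sqrtNegThree) / 3) + hPoly (3 * n) (sqrtNegThree / 3)).im ∧
      -- the Lambert series converge, and they evaluate `ζ(k)`
      (∀ d ∈ ({2, 3, 6, 12} : Finset ℕ),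
        Summable (fun m : ℕ => lambertTerm k (q3 ^ d) (m + 1))) ∧
      riemannZeta (k : ℂ) =
        (((E k 0 : ℝ) * Real.sqrt 3 * Real.pi ^ k +
          ∑ d ∈ ({2, 3, 6, 12} : Finset ℕ), (E k d : ℝ) * lambertS k (q3 ^ d) : ℝ) : ℂ) ∧
      -- the series for `S_k(q_3 ^ d)` has merit `3 d ^ 2`, and the whole combination has merit `12`
      (∀ d ∈ ({2, 3, 6, 12} : Finset ℕ),
        HasMerit (fun m : ℕ => lambertTerm k (q3 ^ d) (m + 1)) (3 * (d : ℝ) ^ 2)) ∧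
      HasMerit (fun m : ℕ => ∑ d ∈ ({2, 3, 6, 12} : Finset ℕ),
        (E k d : ℝ) * lambertTerm k (q3 ^ d) (m + 1)) 12 := by
  choose y hy using fun n : ℕ => exists_im_hPoly_eq (3 * n)
  let c : ℕ → ℕ → ℚ := fun n d =>
    if d = 0 then 2 ^ (6 * n) * 3 ^ (6 * n) * y n / ((6 * n + 2).factorial * eSeq n)
    else if d = 2 then -(fSeq n / eSeq n) - 2
    else if d = 3 then -(fSeq n / eSeq n)
    else if d = 6 then fSeq n * (fSeq n / eSeq n) / 2 ^ (6 * n)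
    else -(fSeq n / eSeq n) / 2 ^ (6 * n)
  -- The coefficients are indexed by k, so n is recovered as (k - 1)/6.
  refine ⟨fun k d => c ((k - 1) / 6) d, ?_⟩
  rintro n k hn rfl
  have hk : 2 ≤ 6 * n + 1 := by omega
  have hidx : (6 * n + 1 - 1) / 6 = n := by omega
  simp only [hidx]
  have he := eSeq_pos hn
  have hf : 0 < fSeq n := by unfold fSeq; positivity
  have hd : ∀ d ∈ ({2, 3, 6, 12} : Finset ℕ), d ≠ 0 := by decide
  refine ⟨⟨he, exists_eSeq_eq n⟩, ⟨?_, ?_, ?_, ?_⟩, normalizedCoeff_eq hn (hy n),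
    fun d hdm => summable_lambertTerm hk (pow_pos q3_pos d)
      (pow_lt_one₀ q3_pos.le q3_lt_one (hd d hdm)), ?_,
    fun d hdm => hasMerit_lambertTerm _ (hd d hdm), hasMerit_combination _ (fun d => (c n d : ℝ)) ?_⟩
  · simp [c]
  · simp [c]
  · simp only [c]
    norm_num
    field_simp
  · simp only [c]
    norm_num
    field_simp
  · rw [riemannZeta_eq_lambertS hn (hy n)]
    simp [c]
  · have : c n 2 < 0 := by
      have := div_pos hf he
      simp only [c]
      norm_num
      linarith
    exact Rat.cast_ne_zero.2 this.ne
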